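/- Epstein's theorem. Let $n, \ell$ be natural numbers, let $B$ be any complex $n\times \ell$ matrix, and let $0<p<1$. Let $M_n^+(\mathbb C)$ denote the convex cone of positive semidefinite complex $n\times n$ matrices, and for a positive semidefinite matrix $X$ and $r>0$ let $X^r$ be defined by the spectral calculus (with $0^r=0$). Then the function $$A \mapsto \operatorname{tr}\left[(B^*A^{p}B)^{1/p}\right]$$ is concave on $M_n^+(\mathbb C)$. -/

import Mathlib

open scoped ComplexOrder Matrix MatrixOrder

open MeasureTheory Set

namespace Matrix

/-! Put `X = Bᴴ * A ^ p * B` and `Y = X ^ (1 / p)`, so that `tr (X * Y ^ (1 - p)) = tr Y`. For a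
convex combination of `A₁`, `A₂`, with `Y` now the same combination of `Y₁`, `Y₂`, Lieb's joint
concavity gives `tr Y ≤ tr (X * Y ^ (1 - p))`. Young's trace inequality bounds the right side by `p
* tr (X ^ (1 / p)) + (1 - p) * tr Y`; cancelling leaves `p` times the claim.

Lieb's theorem follows by writing `a ^ p * y ^ (1 - p)` as a positive integral over `t` of parallel
sums `a * (t * y) / (a + t * y)`. Each of these yields a minimum over `Z` of expressions linear in
`(A, Y)`, hence a concave function. -/

lemma PosSemidef.convexComb {n : Type*} {A₁ A₂ : Matrix n n ℂ} (h₁ : A₁.PosSemidef) (h₂ : A₂.PosSemidef)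
    {a b : ℝ} (ha : 0 ≤ a) (hb : 0 ≤ b) : (a • A₁ + b • A₂).PosSemidef :=
  (h₁.smul ha).add (h₂.smul hb)

variable {m n : Type*} [Fintype m] [Fintype n] [DecidableEq m] [DecidableEq n]

/-- The sum of `k (λᵢ) (μⱼ) |⟨uᵢ, B vⱼ⟩|²` over the eigenpairs of `A` and of `Y`. -/
noncomputable def eigenSum {A : Matrix n n ℂ} {Y : Matrix m m ℂ} (hA : A.IsHermitian)
    (hY : Y.IsHermitian) (B : Matrix n m ℂ) (k : ℝ → ℝ → ℝ) : ℝ :=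
  ∑ i, ∑ j, k (hA.eigenvalues i) (hY.eigenvalues j) *
    Complex.normSq (((hA.eigenvectorUnitary : Matrix n n ℂ)ᴴ * B *
      (hY.eigenvectorUnitary : Matrix m m ℂ)) i j)

lemma trace_conjTranspose_mul_diagonal_mul_diagonal (W : Matrix n m ℂ) (f : n → ℝ) (g : m → ℝ) :
    (trace (Wᴴ * diagonal (fun i => (f i : ℂ)) * W * diagonal (fun j => (g j : ℂ)))).re =
      ∑ i, ∑ j, f i * g j * Complex.normSq (W i j) := by
  rw [Finset.sum_comm]
  simp only [trace, diag_apply, mul_diagonal]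
  simp only [mul_apply (M := _ * _), mul_diagonal, Complex.re_sum, Finset.sum_mul]
  refine Finset.sum_congr rfl fun j _ => Finset.sum_congr rfl fun i _ => ?_
  simp [Complex.normSq_apply]
  ring

lemma IsHermitian.cfc_eq_mul {A : Matrix n n ℂ} (hA : A.IsHermitian) (f : ℝ → ℝ) :
    hA.cfc f = (hA.eigenvectorUnitary : Matrix n n ℂ) *
      diagonal (fun i => (f (hA.eigenvalues i) : ℂ)) *
        (hA.eigenvectorUnitary : Matrix n n ℂ)ᴴ := by
  rw [IsHermitian.cfc, Unitary.conjStarAlgAut_apply]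
  rfl

lemma IsHermitian.cfc_id {A : Matrix n n ℂ} (hA : A.IsHermitian) : hA.cfc (fun x => x) = A :=
  hA.spectral_theorem.symm

lemma IsHermitian.cfc_one {A : Matrix n n ℂ} (hA : A.IsHermitian) : hA.cfc (fun _ => 1) = 1 := by
  rw [← hA.cfc_eq, cfc_const_one ℝ A]

lemma PosSemidef.rpow_eq_cfc {A : Matrix n n ℂ} (hA : A.PosSemidef) (r : ℝ) :
    A ^ r = hA.isHermitian.cfc (fun x => x ^ r) := by
  rw [CFC.rpow_eq_cfc_real (ha := hA.nonneg), hA.isHermitian.cfc_eq]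

lemma re_trace_cfc_mul_cfc {A : Matrix n n ℂ} {Y : Matrix m m ℂ} (hA : A.IsHermitian)
    (hY : Y.IsHermitian) (B : Matrix n m ℂ) (f g : ℝ → ℝ) :
    (trace (Bᴴ * hA.cfc f * B * hY.cfc g)).re = eigenSum hA hY B (fun a y => f a * g y) := by
  rw [eigenSum, ← trace_conjTranspose_mul_diagonal_mul_diagonal, hA.cfc_eq_mul, hY.cfc_eq_mul]
  simp only [← Matrix.mul_assoc]
  rw [trace_mul_comm]
  simp only [conjTranspose_mul, conjTranspose_conjTranspose, Matrix.mul_assoc]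

lemma re_trace_rpow_mul_rpow {A : Matrix n n ℂ} {Y : Matrix m m ℂ} (hA : A.PosSemidef)
    (hY : Y.PosSemidef) (B : Matrix n m ℂ) (p q : ℝ) :
    (trace (Bᴴ * A ^ p * B * Y ^ q)).re =
      eigenSum hA.isHermitian hY.isHermitian B (fun a y => a ^ p * y ^ q) := by
  rw [hA.rpow_eq_cfc, hY.rpow_eq_cfc, re_trace_cfc_mul_cfc]

lemma re_trace_quadratic_left {A : Matrix n n ℂ} {Y : Matrix m m ℂ} (hA : A.IsHermitian)
    (hY : Y.IsHermitian) (B : Matrix n m ℂ) :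
    (trace (Bᴴ * A * B)).re = eigenSum hA hY B (fun a _ => a) := by
  have := re_trace_cfc_mul_cfc hA hY B (fun x => x) (fun _ => 1)
  simpa only [hA.cfc_id, hY.cfc_one, Matrix.mul_one, mul_one] using this

lemma re_trace_quadratic_right {A : Matrix n n ℂ} {Y : Matrix m m ℂ} (hA : A.IsHermitian)
    (hY : Y.IsHermitian) (B : Matrix n m ℂ) :
    (trace (Bᴴ * B * Y)).re = eigenSum hA hY B (fun _ y => y) := by
  have := re_trace_cfc_mul_cfc hA hY B (fun _ => 1) (fun x => x)
  simpa only [hA.cfc_one, hY.cfc_id, Matrix.mul_one, one_mul] using this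

/-- After multiplication by `α + β`, the gap is `|α (b - z) - β z|²`. If `α + β = 0`, the left side
is zero by the division convention. -/
lemma parallelSum_mul_normSq_le {α β : ℝ} (hα : 0 ≤ α) (hβ : 0 ≤ β) (b z : ℂ) :
    α * β / (α + β) * Complex.normSq b ≤ α * Complex.normSq (b - z) + β * Complex.normSq z := by
  have h1 : 0 ≤ Complex.normSq (b - z) := Complex.normSq_nonneg _
  have h2 : 0 ≤ Complex.normSq z := Complex.normSq_nonneg _
  rcases (add_nonneg hα hβ).eq_or_lt with h | h
  · rw [← h]
    simp only [div_zero, zero_mul]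
    positivity
  · rw [div_mul_eq_mul_div, div_le_iff₀ h]
    simp only [Complex.normSq_apply, Complex.sub_re, Complex.sub_im]
    nlinarith [sq_nonneg (α * (b.re - z.re) - β * z.re), sq_nonneg (α * (b.im - z.im) - β * z.im)]

lemma parallelSum_mul_normSq_eq {α β : ℝ} (hα : 0 ≤ α) (hβ : 0 ≤ β) (b : ℂ) :
    α * Complex.normSq (b - (α / (α + β) : ℝ) * b) +
      β * Complex.normSq ((α / (α + β) : ℝ) * b) = α * β / (α + β) * Complex.normSq b := by
  rcases (add_nonneg hα hβ).eq_or_lt with h | h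
  · obtain rfl : α = 0 := by linarith
    obtain rfl : β = 0 := by linarith
    simp
  · rw [← one_sub_mul, ← Complex.ofReal_one, ← Complex.ofReal_sub, Complex.normSq_mul,
      Complex.normSq_mul, Complex.normSq_ofReal, Complex.normSq_ofReal]
    field_simp
    ring

lemma eigenSum_parallel_le {A : Matrix n n ℂ} {Y : Matrix m m ℂ} (hA : A.PosSemidef)
    (hY : Y.PosSemidef) (B Z : Matrix n m ℂ) {t : ℝ} (ht : 0 ≤ t) :
    eigenSum hA.isHermitian hY.isHermitian B (fun a y => a * (t * y) / (a + t * y)) ≤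
      (trace ((B - Z)ᴴ * A * (B - Z))).re + t * (trace (Zᴴ * Z * Y)).re := by
  rw [re_trace_quadratic_left hA.isHermitian hY.isHermitian,
    re_trace_quadratic_right hA.isHermitian hY.isHermitian]
  simp only [eigenSum, Finset.mul_sum, ← Finset.sum_add_distrib]
  refine Finset.sum_le_sum fun i _ => Finset.sum_le_sum fun j _ => ?_
  rw [Matrix.mul_sub, Matrix.sub_mul, sub_apply, ← mul_assoc t]
  exact parallelSum_mul_normSq_le (hA.eigenvalues_nonneg i)
    (mul_nonneg ht (hY.eigenvalues_nonneg j)) _ _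

lemma exists_eigenSum_parallel_eq {A : Matrix n n ℂ} {Y : Matrix m m ℂ} (hA : A.PosSemidef)
    (hY : Y.PosSemidef) (B : Matrix n m ℂ) {t : ℝ} (ht : 0 ≤ t) :
    ∃ Z : Matrix n m ℂ,
      (trace ((B - Z)ᴴ * A * (B - Z))).re + t * (trace (Zᴴ * Z * Y)).re =
        eigenSum hA.isHermitian hY.isHermitian B (fun a y => a * (t * y) / (a + t * y)) := by
  set U := (hA.isHermitian.eigenvectorUnitary : Matrix n n ℂ) with hU
  set V := (hY.isHermitian.eigenvectorUnitary : Matrix m m ℂ) with hV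
  have hUU : Uᴴ * U = 1 := Unitary.coe_star_mul_self hA.isHermitian.eigenvectorUnitary
  have hVV : Vᴴ * V = 1 := Unitary.coe_star_mul_self hY.isHermitian.eigenvectorUnitary
  -- In the two eigenbases the problem decouples into entries; each takes the scalar minimizer `α /
  -- (α + β) * b`.
  let W : Matrix n m ℂ := of fun i j =>
    ((hA.isHermitian.eigenvalues i / (hA.isHermitian.eigenvalues i +
      t * hY.isHermitian.eigenvalues j) : ℝ) : ℂ) * (Uᴴ * B * V) i j
  refine ⟨U * W * Vᴴ, ?_⟩
  have hW : Uᴴ * (U * W * Vᴴ) * V = W := by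
    rw [← Matrix.mul_assoc, ← Matrix.mul_assoc, hUU, Matrix.one_mul, Matrix.mul_assoc, hVV,
      Matrix.mul_one]
  rw [re_trace_quadratic_left hA.isHermitian hY.isHermitian,
    re_trace_quadratic_right hA.isHermitian hY.isHermitian]
  simp only [eigenSum, Finset.mul_sum, ← Finset.sum_add_distrib]
  refine Finset.sum_congr rfl fun i _ => Finset.sum_congr rfl fun j _ => ?_
  rw [Matrix.mul_sub, Matrix.sub_mul, ← hU, ← hV, hW, sub_apply, ← mul_assoc t]
  exact parallelSum_mul_normSq_eq (hA.eigenvalues_nonneg i)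
    (mul_nonneg ht (hY.eigenvalues_nonneg j)) _

/-- The `Z` optimal for the combination is a competitor for both endpoints, and for fixed `Z` the
bound is linear in `(A, Y)`. -/
lemma eigenSum_parallel_concave {A₁ A₂ : Matrix n n ℂ} {Y₁ Y₂ : Matrix m m ℂ}
    (hA₁ : A₁.PosSemidef) (hA₂ : A₂.PosSemidef) (hY₁ : Y₁.PosSemidef) (hY₂ : Y₂.PosSemidef)
    (B : Matrix n m ℂ) {a b t : ℝ} (ha : 0 ≤ a) (hb : 0 ≤ b) (ht : 0 ≤ t) :
    a * eigenSum hA₁.isHermitian hY₁.isHermitian B (fun a y => a * (t * y) / (a + t * y)) +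
      b * eigenSum hA₂.isHermitian hY₂.isHermitian B (fun a y => a * (t * y) / (a + t * y)) ≤
    eigenSum (hA₁.convexComb hA₂ ha hb).isHermitian (hY₁.convexComb hY₂ ha hb).isHermitian B
      (fun a y => a * (t * y) / (a + t * y)) := by
  obtain ⟨Z, hZ⟩ := exists_eigenSum_parallel_eq (hA₁.convexComb hA₂ ha hb)
    (hY₁.convexComb hY₂ ha hb) B ht
  have h₁ := mul_le_mul_of_nonneg_left (eigenSum_parallel_le hA₁ hY₁ B Z ht) ha
  have h₂ := mul_le_mul_of_nonneg_left (eigenSum_parallel_le hA₂ hY₂ B Z ht) hb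
  rw [← hZ]
  simp only [Matrix.mul_add, Matrix.add_mul, Matrix.mul_smul, Matrix.smul_mul, trace_add,
    trace_smul, Complex.add_re, Complex.smul_re, smul_eq_mul]
  linarith

/-- The factor in front of the parallel sum is nonnegative and independent of `a` and `y`, so
concavity survives integration. -/
lemma mul_rpowIntegrand_div {p t a y : ℝ} (hp : p ∈ Ioo (0 : ℝ) 1) (ht : 0 < t) (ha : 0 ≤ a)
    (hy : 0 ≤ y) :
    y * Real.rpowIntegrand₀₁ p t (a / y) = t ^ (p - 1) * t⁻¹ * (a * (t * y) / (a + t * y)) := by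
  rw [Real.rpowIntegrand₀₁_eq_pow_div hp ht.le (div_nonneg ha hy)]
  rcases hy.eq_or_lt with rfl | hy
  · simp
  · have h1 : t + a / y ≠ 0 := by positivity
    have h2 : a + t * y ≠ 0 := by positivity
    have h3 : t * y + a ≠ 0 := by positivity
    field_simp
    ring

lemma rpow_mul_rpow_one_sub {p a y : ℝ} (hp : p ∈ Ioo (0 : ℝ) 1) (ha : 0 ≤ a) (hy : 0 ≤ y) :
    a ^ p * y ^ (1 - p) = y * (a / y) ^ p := by
  rcases hy.eq_or_lt with rfl | hy
  · rw [Real.zero_rpow (by linarith [hp.2]), mul_zero, zero_mul]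
  · rw [Real.div_rpow ha hy.le, Real.rpow_sub hy, Real.rpow_one]
    ring

/-- Lieb's concavity theorem for exponents `p` and `1 - p`. -/
theorem re_trace_rpow_mul_rpow_one_sub_concave {A₁ A₂ : Matrix n n ℂ} {Y₁ Y₂ : Matrix m m ℂ}
    (hA₁ : A₁.PosSemidef) (hA₂ : A₂.PosSemidef) (hY₁ : Y₁.PosSemidef) (hY₂ : Y₂.PosSemidef)
    (B : Matrix n m ℂ) {a b p : ℝ} (ha : 0 ≤ a) (hb : 0 ≤ b) (hp : p ∈ Ioo (0 : ℝ) 1) :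
    a * (trace (Bᴴ * A₁ ^ p * B * Y₁ ^ (1 - p))).re +
      b * (trace (Bᴴ * A₂ ^ p * B * Y₂ ^ (1 - p))).re ≤
    (trace (Bᴴ * (a • A₁ + b • A₂) ^ p * B * (a • Y₁ + b • Y₂) ^ (1 - p))).re := by
  obtain ⟨μ, hμ⟩ := Real.exists_measure_rpow_eq_integral_rpowIntegrand₀₁ hp
  have key : ∀ {A : Matrix n n ℂ} {Y : Matrix m m ℂ} (hA : A.PosSemidef) (hY : Y.PosSemidef),
      IntegrableOn (fun t => eigenSum hA.isHermitian hY.isHermitian B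
          (fun a y => y * Real.rpowIntegrand₀₁ p t (a / y))) (Ioi 0) μ ∧
        (trace (Bᴴ * A ^ p * B * Y ^ (1 - p))).re =
          ∫ t in Ioi 0, eigenSum hA.isHermitian hY.isHermitian B
            (fun a y => y * Real.rpowIntegrand₀₁ p t (a / y)) ∂μ := by
    intro A Y hA hY
    have hint : ∀ i j, IntegrableOn (fun t => hY.isHermitian.eigenvalues j *
        Real.rpowIntegrand₀₁ p t (hA.isHermitian.eigenvalues i / hY.isHermitian.eigenvalues j) *
        Complex.normSq (((hA.isHermitian.eigenvectorUnitary : Matrix n n ℂ)ᴴ * B *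
          (hY.isHermitian.eigenvectorUnitary : Matrix m m ℂ)) i j)) (Ioi 0) μ := fun i j =>
      ((hμ _ (div_nonneg (hA.eigenvalues_nonneg i) (hY.eigenvalues_nonneg j))).1.const_mul
        _).mul_const _
    refine ⟨integrable_finsetSum _ fun i _ => integrable_finsetSum _ fun j _ => hint i j, ?_⟩
    rw [re_trace_rpow_mul_rpow hA hY]
    simp only [eigenSum]
    rw [integral_finsetSum _ fun i _ => integrable_finsetSum _ fun j _ => hint i j]
    refine Finset.sum_congr rfl fun i _ => ?_
    rw [integral_finsetSum _ fun j _ => hint i j]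
    refine Finset.sum_congr rfl fun j _ => ?_
    rw [integral_mul_const, integral_const_mul, rpow_mul_rpow_one_sub hp (hA.eigenvalues_nonneg i)
      (hY.eigenvalues_nonneg j), (hμ _ (div_nonneg (hA.eigenvalues_nonneg i)
        (hY.eigenvalues_nonneg j))).2]
  have hker : ∀ {A : Matrix n n ℂ} {Y : Matrix m m ℂ} (hA : A.PosSemidef) (hY : Y.PosSemidef)
      {t : ℝ}, 0 < t → eigenSum hA.isHermitian hY.isHermitian B
          (fun a y => y * Real.rpowIntegrand₀₁ p t (a / y)) =
        t ^ (p - 1) * t⁻¹ * eigenSum hA.isHermitian hY.isHermitian B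
          (fun a y => a * (t * y) / (a + t * y)) := by
    intro A Y hA hY t ht
    simp only [eigenSum, Finset.mul_sum]
    refine Finset.sum_congr rfl fun i _ => Finset.sum_congr rfl fun j _ => ?_
    rw [mul_rpowIntegrand_div hp ht (hA.eigenvalues_nonneg i) (hY.eigenvalues_nonneg j), mul_assoc]
  have k₁ := key hA₁ hY₁
  have k₂ := key hA₂ hY₂
  have k := key (hA₁.convexComb hA₂ ha hb) (hY₁.convexComb hY₂ ha hb)
  rw [k₁.2, k₂.2, k.2, ← integral_const_mul, ← integral_const_mul,
    ← integral_add (k₁.1.const_mul a) (k₂.1.const_mul b)]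
  refine setIntegral_mono_on ((k₁.1.const_mul a).add (k₂.1.const_mul b)) k.1 measurableSet_Ioi
    fun t (ht : 0 < t) => ?_
  rw [hker hA₁ hY₁ ht, hker hA₂ hY₂ ht,
    hker (hA₁.convexComb hA₂ ha hb) (hY₁.convexComb hY₂ ha hb) ht]
  have h := mul_le_mul_of_nonneg_left (eigenSum_parallel_concave hA₁ hA₂ hY₁ hY₂ B ha hb ht.le)
    (show 0 ≤ t ^ (p - 1) * t⁻¹ by positivity)
  linarith

/-- Young's inequality for traces. -/
lemma re_trace_mul_rpow_one_sub_le {X Y : Matrix n n ℂ} (hX : X.PosSemidef) (hY : Y.PosSemidef)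
    {p : ℝ} (hp : p ∈ Ioo (0 : ℝ) 1) :
    (trace (X * Y ^ (1 - p))).re ≤ p * (trace (X ^ (1 / p))).re + (1 - p) * (trace Y).re := by
  -- With `B = 1`, all three traces become sums with the same nonnegative weights, so scalar Young
  -- applies termwise.
  have h₁ := re_trace_cfc_mul_cfc hX.isHermitian hY.isHermitian 1 (fun x => x)
    (fun y => y ^ (1 - p))
  have h₂ := re_trace_cfc_mul_cfc hX.isHermitian hY.isHermitian 1 (fun x => x ^ (1 / p))
    (fun _ => 1)
  have h₃ := re_trace_cfc_mul_cfc hX.isHermitian hY.isHermitian 1 (fun _ => 1) (fun y => y)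
  rw [← hY.rpow_eq_cfc, IsHermitian.cfc_id] at h₁
  rw [← hX.rpow_eq_cfc, IsHermitian.cfc_one] at h₂
  rw [IsHermitian.cfc_one, IsHermitian.cfc_id] at h₃
  simp only [conjTranspose_one, Matrix.one_mul, Matrix.mul_one] at h₁ h₂ h₃
  rw [h₁, h₂, h₃]
  simp only [eigenSum, Finset.mul_sum, ← Finset.sum_add_distrib]
  refine Finset.sum_le_sum fun i _ => Finset.sum_le_sum fun j _ => ?_
  have hx := hX.eigenvalues_nonneg i
  have hy := hY.eigenvalues_nonneg j
  have hxy := Real.geom_mean_le_arith_mean2_weighted hp.1.le (sub_nonneg.2 hp.2.le)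
    (Real.rpow_nonneg hx (1 / p)) hy (by ring)
  rw [← Real.rpow_mul hx, one_div_mul_cancel hp.1.ne', Real.rpow_one] at hxy
  have := mul_le_mul_of_nonneg_right hxy (Complex.normSq_nonneg
    (((hX.isHermitian.eigenvectorUnitary : Matrix n n ℂ)ᴴ * (1 : Matrix n n ℂ) *
      (hY.isHermitian.eigenvectorUnitary : Matrix n n ℂ) : Matrix n n ℂ) i j))
  linarith

/-- This is the equality case `Y = X ^ (1 / p)` of Young. -/
lemma mul_rpow_rpow_one_sub {X : Matrix n n ℂ} (hX : X.PosSemidef) {p : ℝ}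
    (hp : p ∈ Ioo (0 : ℝ) 1) : X * (X ^ (1 / p)) ^ (1 - p) = X ^ (1 / p) := by
  rw [CFC.rpow_rpow_of_exponent_nonneg X _ _ (one_div_nonneg.2 hp.1.le) (sub_nonneg.2 hp.2.le)
    hX.nonneg, CFC.rpow_eq_cfc_real (ha := hX.nonneg), CFC.rpow_eq_cfc_real (ha := hX.nonneg)]
  have hc : ∀ f : ℝ → ℝ, ContinuousOn f (spectrum ℝ X) := fun f => by
    rw [hX.isHermitian.spectrum_real_eq_range_eigenvalues]
    exact (finite_range _).continuousOn f
  nth_rw 1 [← cfc_id' ℝ X hX.isHermitian.isSelfAdjoint]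
  rw [← cfc_mul _ _ X (hc _) (hc _)]
  refine cfc_congr fun x hx => ?_
  have hx0 : 0 ≤ x := spectrum_nonneg_of_nonneg hX.nonneg hx
  have hp0 := hp.1
  have hp1 := hp.2
  have hs : 1 / p = 1 + 1 / p * (1 - p) := by field_simp; ring
  -- The total exponent is nonzero, so the splitting also holds at `x = 0`.
  conv_rhs => rw [hs, Real.rpow_one_add' hx0 (by rw [← hs]; positivity)]

end Matrix

theorem theorem7p4 {n l : ℕ} (B : Matrix (Fin n) (Fin l) ℂ) {p : ℝ} (hp0 : 0 < p) (hp1 : p < 1) :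
    ConcaveOn ℝ {A : Matrix (Fin n) (Fin n) ℂ | A.PosSemidef}
      (fun A => (Matrix.trace ((Bᴴ * A ^ p * B) ^ (1 / p))).re) := by
  have hp : p ∈ Ioo (0 : ℝ) 1 := ⟨hp0, hp1⟩
  refine ⟨fun A₁ h₁ A₂ h₂ a b ha hb _ => Matrix.PosSemidef.convexComb h₁ h₂ ha hb, ?_⟩
  intro A₁ h₁ A₂ h₂ a b ha hb _
  have hX : ∀ A : Matrix (Fin n) (Fin n) ℂ, (Bᴴ * A ^ p * B).PosSemidef := fun A =>
    (Matrix.nonneg_iff_posSemidef.1 (CFC.rpow_nonneg (a := A))).conjTranspose_mul_mul_same B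
  have hY : ∀ A : Matrix (Fin n) (Fin n) ℂ, ((Bᴴ * A ^ p * B) ^ (1 / p)).PosSemidef := fun A =>
    Matrix.nonneg_iff_posSemidef.1 CFC.rpow_nonneg
  have lieb := Matrix.re_trace_rpow_mul_rpow_one_sub_concave h₁ h₂ (hY A₁) (hY A₂) B ha hb hp
  have young := Matrix.re_trace_mul_rpow_one_sub_le (hX (a • A₁ + b • A₂))
    ((hY A₁).convexComb (hY A₂) ha hb) hp
  rw [Matrix.mul_rpow_rpow_one_sub (hX A₁) hp, Matrix.mul_rpow_rpow_one_sub (hX A₂) hp] at lieb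
  simp only [Matrix.trace_add, Matrix.trace_smul, Complex.add_re, Complex.smul_re,
    smul_eq_mul] at young ⊢
  -- The factor `p` is what remains once `(1 - p) * tr Y` is subtracted.
  refine le_of_mul_le_mul_left ?_ hp0
  linarith
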